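/- **Setting.** Let $\mathscr V$ be a closed symmetric monoidal category with a model structure satisfying the usual compatibility axiom of a symmetric monoidal model category: the pushout-product of two cofibrations $i,j$ has the left lifting property with respect to every fibration $p$ whenever at least one of $i,j,p$ is a weak equivalence. For an algebra (monoid) $A$ in $\mathscr V$ let $\mathscr V_A$ be the category of right $A$-modules. An $A$-*coring* $C$ is a comonoid, with comultiplication $\Delta$ and counit $\epsilon$, in the monoidal category of $A$-$A$-bimodules under $\otimes_A$; let $\mathscr V_A^C$ be the category of right $C$-comodules, i.e. right $A$-modules $M$ with a coassociative and counital coaction $\delta\colon M\to M\otimes_A C$. Assume that for every algebra $A$ a model structure on $\mathscr V_A$ is given and that for every coring $(A,C)$ the category $\mathscr V_A^C$ has the model structure left-induced from that of $\mathscr V_A$: a morphism of comodules is a weak equivalence (respectively a cofibration) if and only if it is one in $\mathscr V_A$. **Braided bimodules.** A *braided bimodule* $(X,T)\colon(A,C)\to(B,D)$ consists of an $A$-$B$-bimodule $X$ and a morphism of $A$-$B$-bimodules $T\colon C\otimes_A X\to X\otimes_B D$ such that, up to associativity and unit isomorphisms, $(1_X\otimes\Delta_D)T=(T\otimes 1_D)(1_C\otimes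 T)(\Delta_C\otimes 1_X)$ and $(1_X\otimes\epsilon_D)T=\epsilon_C\otimes 1_X$. It induces the functor $T_*\colon\mathscr V_A^C\to\mathscr V_B^D$ sending $(M,\delta)$ to $M\otimes_A X$ with coaction $(1_M\otimes T)(\delta\otimes 1_X)$. The right adjoint of $T_*$ (which exists under the assumptions below) is denoted $T^*$. The bimodule $X$ is *strictly (right) dualizable* if there are a $B$-$A$-bimodule $X^\vee$ and bimodule maps $u\colon A\to X\otimes_B X^\vee$, $e\colon X^\vee\otimes_A X\to B$ satisfying the two triangle identities. In that case: * the *canonical coring* is the $B$-coring $X_*(C)=X^\vee\otimes_A C\otimes_A X$, whose comultiplication applies $\Delta_C$ and then inserts $u$ between the two copies of $C$, and whose counit is $e\,(1\otimes\epsilon_C\otimes 1)$; $(X,T^{\mathrm{univ}})\colon(A,C)\to(B,X_*(C))$ with $T^{\mathrm{univ}}=u\otimes 1_{C\otimes_A X}$ is a braided bimodule, and the adjunction $\mathscr V_A^C\rightleftarrows\mathscr V_B^{X_*(C)}$ that it governs is denoted $\operatorname{Can}_X\dashv\operatorname{Prim}_X$; * $X$ *satisfies effective homotopic descent with respect to $C$*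 if $\operatorname{Can}_X\dashv\operatorname{Prim}_X$ is a Quillen equivalence; * $g_T\colon X_*(C)\to D$ is the morphism of $B$-corings $(e\otimes 1_D)(1_{X^\vee}\otimes T)$. A morphism $f\colon C'\to D$ of $B$-corings induces $f_*\colon\mathscr V_B^{C'}\to\mathscr V_B^{D}$, $(M,\delta)\mapsto(M,(1_M\otimes f)\delta)$, with right adjoint $f^*$. It is a *copure weak equivalence* if $f$ is a weak equivalence in $\mathscr V_B$ and the counit $f_*f^*M\to M$ is a weak equivalence for every fibrant $M$ in $\mathscr V_B^{D}$. The coring $(A,C)$ is *flat* if $-\otimes_A C\colon\mathscr V_A\to\mathscr V$ preserves coreflexive equalizers. The left $A$-module $X$ is *strongly homotopy flat* if $-\otimes_A X\colon\mathscr V_A\to\mathscr V$ preserves weak equivalences and, for every finite category $J$ and every functor $\Phi\colon J\to\mathscr V_A$, the natural map $(\lim_J\Phi)\otimes_A X\to\lim_J(\Phi\otimes_A X)$ is a weak equivalence in $\mathscr V$. **Theorem (homotopical Morita–Takeuchi theorem).** Let $(X,T)\colon(A,C)\to(B,D)$ be a braided bimodule such that $X$ is strictly right dualizable and $-\otimes_A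 X\colon\mathscr V_A\to\mathscr V_B$ is a left Quillen functor. 1. If $X$ satisfies effective homotopic descent with respect to $C$ and $g_T\colon X_*(C)\to D$ is a copure weak equivalence of corings, then $T_*\dashv T^*$ is a Quillen equivalence between $\mathscr V_A^C$ and $\mathscr V_B^D$. 2. Conversely, suppose that every morphism of $\mathscr V_B$ that is a weak equivalence in $\mathscr V$ is a weak equivalence in $\mathscr V_B$, that $B$ is fibrant in $\mathscr V_B$, that the coring $(A,C)$ is flat and that the left $A$-module $X$ is strongly homotopy flat. If $T_*\dashv T^*$ is a Quillen equivalence, then $X$ satisfies effective homotopic descent with respect to $C$ and $g_T\colon X_*(C)\to D$ is a copure weak equivalence of corings. -/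

import Mathlib

universe v u

open CategoryTheory Limits HomotopicalAlgebra

namespace MoritaTakeuchi

/-! ### Corings, comodules and braided bimodules in a bicategory -/

section Bicat

open Bicategory

universe w v₁ u₁

variable {𝓑 : Type u₁} [Bicategory.{w, v₁} 𝓑] {a b : 𝓑}

/-- The comonad `M ↦ M ≫ C` on the category of 1-morphisms `k ⟶ a` induced by a comonoid `C` of the
monoidal category of endomorphisms of `a`. In the bicategory of algebras and bimodules, with `k` the
unit algebra, this is the comonad `- ⊗_A C` on right `A`-modules. -/
def comoduleComonad (k : 𝓑) (C : Comon (a ⟶ a)) : CategoryTheory.Comonad (k ⟶ a) :=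
  CategoryTheory.Comonad.mk (postcomp k C.X)
    { app := fun M => M ◁ ε[C.X] ≫ (ρ_ M).hom
      naturality := by intros; simp [postcomp, ← whisker_exchange_assoc] }
    { app := fun M => M ◁ Δ[C.X] ≫ (α_ M C.X C.X).inv
      naturality := by intros; simp [postcomp, ← whisker_exchange_assoc] }
    (by
      intro M
      dsimp [postcomp]
      have h := congrArg (fun t => M ◁ t) (Comonad.comul_assoc C.X)
      simp only [Bicategory.whiskerLeft_comp] at h
      simp only [Category.assoc, comp_whiskerRight]
      have e : (α_ M C.X C.X).inv ≫ (M ≫ C.X) ◁ Δ[C.X] ≫ (α_ (M ≫ C.X) C.X C.X).inv =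
        M ◁ C.X ◁ Δ[C.X] ≫ M ◁ (α_ C.X C.X C.X).inv ≫ (α_ M (C.X ≫ C.X) C.X).inv ≫
          (α_ M C.X C.X).inv ▷ C.X := by bicategory
      rw [e, reassoc_of% h]
      bicategory)
    (by
      intro M
      dsimp [postcomp]
      have h := congrArg (fun t => M ◁ t) (Comonad.comul_counit C.X)
      simp only [Bicategory.whiskerLeft_comp] at h
      simp [reassoc_of% h])
    (by
      intro M
      dsimp [postcomp]
      have h := congrArg (fun t => M ◁ t) (Comonad.counit_comul C.X)
      simp only [Bicategory.whiskerLeft_comp] at h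
      simp [reassoc_of% h])

/-- Right comodules over `C`: a 1-morphism `M : k ⟶ a` with a counital and coassociative coaction
`M ⟶ M ≫ C` (see `Comodule.coact` and the three lemmas below it). -/
abbrev Comodule (k : 𝓑) (C : Comon (a ⟶ a)) := (comoduleComonad k C).Coalgebra

section
variable {k : 𝓑} {C : Comon (a ⟶ a)} (M : Comodule k C)

/-- The coaction of a comodule. -/
def Comodule.coact : M.A ⟶ M.A ≫ C.X := M.a

theorem Comodule.coact_counit : M.coact ≫ M.A ◁ ε[C.X] ≫ (ρ_ M.A).hom = 𝟙 M.A := M.counit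

theorem Comodule.coact_coassoc :
    M.coact ≫ M.A ◁ Δ[C.X] ≫ (α_ M.A C.X C.X).inv = M.coact ≫ M.coact ▷ C.X := M.coassoc

theorem Comodule.hom_coact {M N : Comodule k C} (f : M ⟶ N) :
    M.coact ≫ f.f ▷ C.X = f.f ≫ N.coact := f.h

/-- Constructor of comodules with the axioms spelled out. -/
def Comodule.mk' (A : k ⟶ a) (coact : A ⟶ A ≫ C.X)
    (counit : coact ≫ A ◁ ε[C.X] ≫ (ρ_ A).hom = 𝟙 A)
    (coassoc : coact ≫ A ◁ Δ[C.X] ≫ (α_ A C.X C.X).inv = coact ≫ coact ▷ C.X) : Comodule k C where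
  A := A
  a := coact
  counit := counit
  coassoc := coassoc

end

/-- Braided bimodules `(X, T)`: a 1-morphism `X` and a 2-morphism `T : C ≫ X ⟶ X ≫ D` subject to the
pentagon and counit axioms. -/
structure BraidedBimodule (C : Comon (a ⟶ a)) (D : Comon (b ⟶ b)) where
  X : a ⟶ b
  T : C.X ≫ X ⟶ X ≫ D.X
  pentagon : T ≫ X ◁ Δ[D.X] =
    Δ[C.X] ▷ X ≫ (α_ C.X C.X X).hom ≫ C.X ◁ T ≫ (α_ C.X X D.X).inv ≫ T ▷ D.X ≫
      (α_ X D.X D.X).hom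
  counit : T ≫ X ◁ ε[D.X] ≫ (ρ_ X).hom = ε[C.X] ▷ X ≫ (λ_ X).hom

variable {C : Comon (a ⟶ a)} {D : Comon (b ⟶ b)}

/-- The functor `T_*`, sending `(M, δ)` to `M ≫ X` with the coaction `δ ▷ X` followed by `M ◁ T`. -/
def BraidedBimodule.lowerStar (k : 𝓑) (P : BraidedBimodule C D) : Comodule k C ⥤ Comodule k D where
  obj M := Comodule.mk' (M.A ≫ P.X)
      (M.coact ▷ P.X ≫ (α_ M.A C.X P.X).hom ≫ M.A ◁ P.T ≫ (α_ M.A P.X D.X).inv)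
      (by
        have h := congrArg (fun t => M.A ◁ t) P.counit
        have h2 := congrArg (fun t => t ▷ P.X) M.coact_counit
        simp only [Bicategory.whiskerLeft_comp, comp_whiskerRight, id_whiskerRight] at h h2
        rw [← h2]
        have e : (α_ M.A P.X D.X).inv ≫ (M.A ≫ P.X) ◁ ε[D.X] ≫ (ρ_ (M.A ≫ P.X)).hom =
            M.A ◁ P.X ◁ ε[D.X] ≫ M.A ◁ (ρ_ P.X).hom := by bicategory
        simp only [Category.assoc]
        rw [e, h]
        bicategory)
      (by
        have h := congrArg (fun t => M.A ◁ t) P.pentagon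
        have h2 := congrArg (fun t => t ▷ P.X) M.coact_coassoc
        simp only [Bicategory.whiskerLeft_comp, comp_whiskerRight] at h h2
        have e : (α_ M.A P.X D.X).inv ≫ (M.A ≫ P.X) ◁ Δ[D.X] ≫ (α_ (M.A ≫ P.X) D.X D.X).inv =
          M.A ◁ P.X ◁ Δ[D.X] ≫ M.A ◁ (α_ P.X D.X D.X).inv ≫ (α_ M.A (P.X ≫ D.X) D.X).inv ≫
            (α_ M.A P.X D.X).inv ▷ D.X := by bicategory
        simp only [Category.assoc, comp_whiskerRight]
        rw [e, reassoc_of% h]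
        have e2 : M.coact ▷ P.X ≫ (α_ M.A C.X P.X).hom ≫ M.A ◁ P.T ≫ (α_ M.A P.X D.X).inv ≫
          M.coact ▷ P.X ▷ D.X = (M.coact ▷ P.X ≫ M.coact ▷ C.X ▷ P.X) ≫ (α_ (M.A ≫ C.X) C.X P.X).hom ≫
            (M.A ≫ C.X) ◁ P.T ≫ (α_ (M.A ≫ C.X) P.X D.X).inv := by
          have : M.coact ▷ P.X ▷ D.X = (α_ M.A P.X D.X).hom ≫ M.coact ▷ (P.X ≫ D.X) ≫ (α_ (M.A ≫ C.X) P.X D.X).inv := by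
            bicategory
          rw [this]
          simp only [Category.assoc, Iso.inv_hom_id_assoc, whisker_exchange_assoc]
          bicategory
        rw [reassoc_of% e2, ← reassoc_of% h2]
        bicategory)
  map {M N} f :=
    { f := f.f ▷ P.X
      h := by
        have h := congrArg (fun t => t ▷ P.X) (Comodule.hom_coact f)
        simp only [comp_whiskerRight] at h
        change (M.coact ▷ P.X ≫ (α_ M.A C.X P.X).hom ≫ M.A ◁ P.T ≫ (α_ M.A P.X D.X).inv) ≫ f.f ▷ P.X ▷ D.X = f.f ▷ P.X ≫ N.coact ▷ P.X ≫ (α_ N.A C.X P.X).hom ≫ N.A ◁ P.T ≫ (α_ N.A P.X D.X).inv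
        rw [← reassoc_of% h]
        have : f.f ▷ P.X ▷ D.X = (α_ M.A P.X D.X).hom ≫ f.f ▷ (P.X ≫ D.X) ≫ (α_ N.A P.X D.X).inv := by
            bicategory
        rw [this]
        simp only [Category.assoc, Iso.inv_hom_id_assoc, whisker_exchange_assoc]
        bicategory }
  map_id M := by ext; exact id_whiskerRight _ _
  map_comp f g := by ext; exact comp_whiskerRight _ _ _

/-- The change-of-corings functor `f_*`, sending `(M, δ)` to `M` with the coaction `δ ≫ M ◁ f`. -/
def changeOfCorings (k : 𝓑) {C D : Comon (a ⟶ a)} (f : C ⟶ D) : Comodule k C ⥤ Comodule k D where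
  obj M := Comodule.mk' M.A (M.coact ≫ M.A ◁ f.hom)
      (by
        have h := congrArg (fun t => M.A ◁ t) (IsComonHom.hom_counit f.hom)
        simp only [Bicategory.whiskerLeft_comp] at h
        simp only [Category.assoc]
        refine Eq.trans ?_ M.coact_counit
        erw [reassoc_of% h])
      (by
        have h := congrArg (fun t => M.A ◁ t) (IsComonHom.hom_comul f.hom)
        simp only [Bicategory.whiskerLeft_comp] at h
        simp only [Category.assoc, comp_whiskerRight]
        have h' : M.A ◁ f.hom ≫ M.A ◁ Δ[D.X] =
            M.A ◁ Δ[C.X] ≫ M.A ◁ (f.hom ▷ C.X ≫ D.X ◁ f.hom) := h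
        have e : M.A ◁ (f.hom ▷ C.X ≫ D.X ◁ f.hom) ≫ (α_ M.A D.X D.X).inv =
            (α_ M.A C.X C.X).inv ≫ (M.A ◁ f.hom) ▷ C.X ≫ (M.A ≫ D.X) ◁ f.hom := by bicategory
        have h2 := M.coact_coassoc
        rw [reassoc_of% h', e, reassoc_of% h2, whisker_exchange_assoc, whisker_exchange])
  map {M N} φ :=
    { f := φ.f
      h := by
        have h := Comodule.hom_coact φ
        change (M.coact ≫ M.A ◁ f.hom) ≫ φ.f ▷ D.X = φ.f ≫ N.coact ≫ N.A ◁ f.hom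
        rw [← reassoc_of% h, Category.assoc, whisker_exchange] }

/-- The adjunction `- ≫ X ⊣ - ≫ Xd` between categories of 1-morphisms out of `k` induced by a dual
pair `X ⊣ Xd`. -/
def postcompAdjunction (k : 𝓑) {X : a ⟶ b} {Xd : b ⟶ a} (adj : Bicategory.Adjunction X Xd) :
    CategoryTheory.Adjunction (postcomp k X) (postcomp k Xd) :=
  CategoryTheory.Adjunction.mkOfUnitCounit
    { unit :=
        { app := fun M => (ρ_ M).inv ≫ M ◁ adj.unit ≫ (α_ M X Xd).inv
          naturality := by
            intro M N f
            dsimp [postcomp]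
            have e : f ▷ X ▷ Xd = (α_ M X Xd).hom ≫ f ▷ (X ≫ Xd) ≫ (α_ N X Xd).inv := by
              bicategory
            rw [e]
            simp only [Category.assoc, Iso.inv_hom_id_assoc, whisker_exchange_assoc]
            bicategory }
      counit :=
        { app := fun M => (α_ M Xd X).hom ≫ M ◁ adj.counit ≫ (ρ_ M).hom
          naturality := by
            intro M N f
            dsimp [postcomp]
            have e : f ▷ Xd ▷ X = (α_ M Xd X).hom ≫ f ▷ (Xd ≫ X) ≫ (α_ N Xd X).inv := by
              bicategory
            rw [e]
            simp only [Category.assoc, Iso.inv_hom_id_assoc, ← whisker_exchange_assoc]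
            bicategory }
      left_triangle := by
        ext M
        dsimp [postcomp]
        calc
          _ = 𝟙 _ ⊗≫ M ◁ leftZigzag adj.unit adj.counit ⊗≫ 𝟙 _ := by bicategory
          _ = _ := by rw [adj.left_triangle]; bicategory
      right_triangle := by
        ext M
        dsimp [postcomp]
        calc
          _ = 𝟙 _ ⊗≫ M ◁ rightZigzag adj.unit adj.counit ⊗≫ 𝟙 _ := by bicategory
          _ = _ := by rw [adj.right_triangle]; bicategory }

theorem isLeftAdjoint_lowerStar (k : 𝓑) (P : BraidedBimodule C D) {Xd : b ⟶ a}
    (adj : Bicategory.Adjunction P.X Xd) [HasCoreflexiveEqualizers (Comodule k C)] :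
    (P.lowerStar k).IsLeftAdjoint :=
  have : (postcomp k P.X).IsLeftAdjoint := (postcompAdjunction k adj).isLeftAdjoint
  isLeftAdjoint_square_lift_comonadic (P.lowerStar k) (comoduleComonad k D).forget
    (comoduleComonad k C).forget (postcomp k P.X) (Iso.refl _)

theorem isLeftAdjoint_changeOfCorings (k : 𝓑) {C D : Comon (a ⟶ a)} (f : C ⟶ D)
    [HasCoreflexiveEqualizers (Comodule k C)] : (changeOfCorings k f).IsLeftAdjoint :=
  isLeftAdjoint_square_lift_comonadic (changeOfCorings k f) (comoduleComonad k D).forget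
    (comoduleComonad k C).forget (𝟭 _) (Iso.refl _)

/-- The functor `T^*`: the right adjoint of `T_*`, for a braided bimodule `(X, T)` whose underlying
1-morphism `X` has a right dual. -/
noncomputable def BraidedBimodule.upperStar (k : 𝓑) (P : BraidedBimodule C D) {Xd : b ⟶ a}
    (adj : Bicategory.Adjunction P.X Xd) [HasCoreflexiveEqualizers (Comodule k C)] :
    Comodule k D ⥤ Comodule k C :=
  have := isLeftAdjoint_lowerStar k P adj
  (P.lowerStar k).rightAdjoint

/-- The adjunction `T_* ⊣ T^*` governed by a braided bimodule. -/
noncomputable def BraidedBimodule.starAdjunction (k : 𝓑) (P : BraidedBimodule C D) {Xd : b ⟶ a}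
    (adj : Bicategory.Adjunction P.X Xd) [HasCoreflexiveEqualizers (Comodule k C)] :
    CategoryTheory.Adjunction (P.lowerStar k) (P.upperStar k adj) :=
  have := isLeftAdjoint_lowerStar k P adj
  CategoryTheory.Adjunction.ofIsLeftAdjoint (P.lowerStar k)

/-- The functor `f^*`: the right adjoint of the change-of-corings functor `f_*`. -/
noncomputable def corestriction (k : 𝓑) {C D : Comon (a ⟶ a)} (f : C ⟶ D)
    [HasCoreflexiveEqualizers (Comodule k C)] : Comodule k D ⥤ Comodule k C :=
  have := isLeftAdjoint_changeOfCorings k f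
  (changeOfCorings k f).rightAdjoint

/-- The change-of-corings adjunction `f_* ⊣ f^*`. -/
noncomputable def changeOfCoringsAdjunction (k : 𝓑) {C D : Comon (a ⟶ a)} (f : C ⟶ D)
    [HasCoreflexiveEqualizers (Comodule k C)] :
    CategoryTheory.Adjunction (changeOfCorings k f) (corestriction k f) :=
  have := isLeftAdjoint_changeOfCorings k f
  CategoryTheory.Adjunction.ofIsLeftAdjoint (changeOfCorings k f)

variable (C) {X : a ⟶ b} {Xd : b ⟶ a} (adj : Bicategory.Adjunction X Xd)

/-- The counit of the canonical coring: apply the counit of `C`, then evaluate. -/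
def canonicalCounit : Xd ≫ C.X ≫ X ⟶ 𝟙 b :=
  Xd ◁ ε[C.X] ▷ X ⊗≫ adj.counit

/-- The comultiplication of the canonical coring: comultiply in `C`, then insert the coevaluation. -/
def canonicalComul : Xd ≫ C.X ≫ X ⟶ (Xd ≫ C.X ≫ X) ≫ Xd ≫ C.X ≫ X :=
  Xd ◁ Δ[C.X] ▷ X ⊗≫ Xd ◁ C.X ◁ adj.unit ▷ (C.X ≫ X) ⊗≫ 𝟙 ((Xd ≫ C.X ≫ X) ≫ Xd ≫ C.X ≫ X)

theorem canonical_counit_comul :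
    canonicalComul C adj ≫ canonicalCounit C adj ▷ (Xd ≫ C.X ≫ X) =
      (λ_ (Xd ≫ C.X ≫ X)).inv := by
  dsimp only [canonicalComul, canonicalCounit]
  calc
    _ = Xd ◁ Δ[C.X] ▷ X ⊗≫ Xd ◁ (C.X ◁ adj.unit ≫ ε[C.X] ▷ (X ≫ Xd)) ▷ (C.X ≫ X) ⊗≫
        adj.counit ▷ (Xd ≫ C.X ≫ X) := by bicategory
    _ = Xd ◁ (Δ[C.X] ≫ ε[C.X] ▷ C.X) ▷ X ⊗≫
        rightZigzag adj.unit adj.counit ▷ (C.X ≫ X) ⊗≫ 𝟙 _ := by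
      rw [whisker_exchange]; bicategory
    _ = _ := by
      rw [adj.right_triangle, Comonad.counit_comul]; bicategory

theorem canonical_comul_counit :
    canonicalComul C adj ≫ (Xd ≫ C.X ≫ X) ◁ canonicalCounit C adj =
      (ρ_ (Xd ≫ C.X ≫ X)).inv := by
  dsimp only [canonicalComul, canonicalCounit]
  calc
    _ = Xd ◁ Δ[C.X] ▷ X ⊗≫ (Xd ≫ C.X) ◁ (adj.unit ▷ C.X ≫ (X ≫ Xd) ◁ ε[C.X]) ▷ X ⊗≫
        (Xd ≫ C.X ≫ X) ◁ adj.counit := by bicategory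
    _ = Xd ◁ (Δ[C.X] ≫ C.X ◁ ε[C.X]) ▷ X ⊗≫
        (Xd ≫ C.X) ◁ leftZigzag adj.unit adj.counit ⊗≫ 𝟙 _ := by
      rw [← whisker_exchange]; bicategory
    _ = _ := by
      rw [adj.left_triangle, Comonad.comul_counit]; bicategory

theorem canonical_comul_assoc :
    canonicalComul C adj ≫ (Xd ≫ C.X ≫ X) ◁ canonicalComul C adj =
      canonicalComul C adj ≫ canonicalComul C adj ▷ (Xd ≫ C.X ≫ X) ≫
        (α_ (Xd ≫ C.X ≫ X) (Xd ≫ C.X ≫ X) (Xd ≫ C.X ≫ X)).hom := by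
  dsimp only [canonicalComul]
  calc
    _ = Xd ◁ Δ[C.X] ▷ X ⊗≫ (Xd ≫ C.X) ◁ (adj.unit ▷ C.X ≫ (X ≫ Xd) ◁ Δ[C.X]) ▷ X ⊗≫
        (Xd ≫ C.X ≫ X ≫ Xd ≫ C.X) ◁ adj.unit ▷ (C.X ≫ X) ⊗≫ 𝟙 _ := by bicategory
    _ = Xd ◁ (Δ[C.X] ≫ C.X ◁ Δ[C.X]) ▷ X ⊗≫ (Xd ≫ C.X) ◁ (adj.unit ▷ (C.X ≫ 𝟙 a) ≫
        (X ≫ Xd) ◁ (C.X ◁ adj.unit)) ▷ (C.X ≫ X) ⊗≫ 𝟙 _ := by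
      rw [← whisker_exchange]; bicategory
    _ = Xd ◁ (Δ[C.X] ≫ Δ[C.X] ▷ C.X ≫ (α_ C.X C.X C.X).hom) ▷ X ⊗≫
        (Xd ≫ C.X) ◁ (𝟙 a ◁ (C.X ◁ adj.unit) ≫ adj.unit ▷ (C.X ≫ X ≫ Xd)) ▷ (C.X ≫ X) ⊗≫
        𝟙 _ := by
      rw [← whisker_exchange, Comonad.comul_assoc]
    _ = Xd ◁ Δ[C.X] ▷ X ⊗≫ Xd ◁ (Δ[C.X] ▷ 𝟙 a ≫ (C.X ≫ C.X) ◁ adj.unit) ▷ (C.X ≫ X) ⊗≫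
        (Xd ≫ C.X) ◁ adj.unit ▷ (C.X ≫ X ≫ Xd ≫ C.X ≫ X) ⊗≫ 𝟙 _ := by bicategory
    _ = _ := by
      rw [← whisker_exchange]; bicategory

/-- The canonical coring `X_*(C) = Xd ≫ C ≫ X` attached to a 1-morphism `X` with right dual `Xd`. -/
def canonicalCoring : Comon (b ⟶ b) where
  X := Xd ≫ C.X ≫ X
  comon :=
    { counit := canonicalCounit C adj
      comul := canonicalComul C adj
      counit_comul := canonical_counit_comul C adj
      comul_counit := canonical_comul_counit C adj
      comul_assoc := canonical_comul_assoc C adj }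

/-- The universal braided bimodule `(X, T^univ) : (a, C) → (b, X_*(C))`, where
`T^univ : C ≫ X ⟶ X ≫ Xd ≫ C ≫ X` inserts the coevaluation. -/
def universalBraiding : BraidedBimodule C (canonicalCoring C adj) where
  X := X
  T := (λ_ (C.X ≫ X)).inv ≫ adj.unit ▷ (C.X ≫ X) ≫ (α_ X Xd (C.X ≫ X)).hom
  pentagon := by
    change ((λ_ (C.X ≫ X)).inv ≫ adj.unit ▷ (C.X ≫ X) ≫ (α_ X Xd (C.X ≫ X)).hom) ≫
      X ◁ canonicalComul C adj = Δ[C.X] ▷ X ≫ (α_ C.X C.X X).hom ≫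
        C.X ◁ ((λ_ (C.X ≫ X)).inv ≫ adj.unit ▷ (C.X ≫ X) ≫ (α_ X Xd (C.X ≫ X)).hom) ≫
        (α_ C.X X (Xd ≫ C.X ≫ X)).inv ≫
        ((λ_ (C.X ≫ X)).inv ≫ adj.unit ▷ (C.X ≫ X) ≫ (α_ X Xd (C.X ≫ X)).hom) ▷
          (Xd ≫ C.X ≫ X) ≫ (α_ X (Xd ≫ C.X ≫ X) (Xd ≫ C.X ≫ X)).hom
    dsimp only [canonicalComul]
    calc
      _ = 𝟙 _ ⊗≫ (adj.unit ▷ C.X ≫ (X ≫ Xd) ◁ Δ[C.X]) ▷ X ⊗≫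
          (X ≫ Xd ≫ C.X) ◁ adj.unit ▷ (C.X ≫ X) ⊗≫ 𝟙 _ := by bicategory
      _ = Δ[C.X] ▷ X ⊗≫ (adj.unit ▷ (C.X ≫ 𝟙 a) ≫ (X ≫ Xd) ◁ (C.X ◁ adj.unit)) ▷ (C.X ≫ X) ⊗≫
          𝟙 _ := by
        rw [← whisker_exchange]; bicategory
      _ = _ := by
        rw [← whisker_exchange]; bicategory
  counit := by
    change ((λ_ (C.X ≫ X)).inv ≫ adj.unit ▷ (C.X ≫ X) ≫ (α_ X Xd (C.X ≫ X)).hom) ≫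
      X ◁ canonicalCounit C adj ≫ (ρ_ X).hom = ε[C.X] ▷ X ≫ (λ_ X).hom
    dsimp only [canonicalCounit]
    calc
      _ = 𝟙 _ ⊗≫ (adj.unit ▷ C.X ≫ (X ≫ Xd) ◁ ε[C.X]) ▷ X ⊗≫ X ◁ adj.counit ⊗≫ 𝟙 _ := by
        bicategory
      _ = ε[C.X] ▷ X ⊗≫ leftZigzag adj.unit adj.counit ⊗≫ 𝟙 _ := by
        rw [← whisker_exchange]; bicategory
      _ = _ := by
        rw [adj.left_triangle]; bicategory

variable {C}

/-- The 2-morphism underlying `g_T`: apply `T`, then evaluate. -/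
def canonicalMapHom (P : BraidedBimodule C D) {Xd : b ⟶ a} (adj : Bicategory.Adjunction P.X Xd) :
    Xd ≫ C.X ≫ P.X ⟶ D.X :=
  Xd ◁ P.T ⊗≫ adj.counit ▷ D.X ⊗≫ 𝟙 D.X

theorem canonicalMapHom_counit (P : BraidedBimodule C D) {Xd : b ⟶ a} (adj : Bicategory.Adjunction P.X Xd) :
    canonicalMapHom P adj ≫ ε[D.X] = canonicalCounit C adj := by
  dsimp only [canonicalMapHom, canonicalCounit]
  calc
    _ = Xd ◁ P.T ⊗≫ (adj.counit ▷ D.X ≫ 𝟙 b ◁ ε[D.X]) ⊗≫ 𝟙 _ := by bicategory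
    _ = Xd ◁ (P.T ≫ P.X ◁ ε[D.X] ≫ (ρ_ P.X).hom) ⊗≫ adj.counit := by
      rw [← whisker_exchange]; bicategory
    _ = _ := by
      rw [P.counit]; bicategory

theorem canonicalMapHom_comul (P : BraidedBimodule C D) {Xd : b ⟶ a} (adj : Bicategory.Adjunction P.X Xd) :
    canonicalMapHom P adj ≫ Δ[D.X] = canonicalComul C adj ≫
      canonicalMapHom P adj ▷ (Xd ≫ C.X ≫ P.X) ≫ D.X ◁ canonicalMapHom P adj := by
  dsimp only [canonicalMapHom, canonicalComul]
  symm
  calc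
    _ = Xd ◁ Δ[C.X] ▷ P.X ⊗≫ (Xd ≫ C.X) ◁ adj.unit ▷ (C.X ≫ P.X) ⊗≫
        Xd ◁ P.T ▷ (Xd ≫ C.X ≫ P.X) ⊗≫
        (adj.counit ▷ (D.X ≫ Xd ≫ C.X ≫ P.X) ≫ 𝟙 b ◁ (D.X ◁ Xd ◁ P.T)) ⊗≫
        D.X ◁ adj.counit ▷ D.X ⊗≫ 𝟙 _ := by bicategory
    _ = Xd ◁ Δ[C.X] ▷ P.X ⊗≫ (Xd ≫ C.X) ◁ adj.unit ▷ (C.X ≫ P.X) ⊗≫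
        Xd ◁ (P.T ▷ (Xd ≫ C.X ≫ P.X) ≫ (P.X ≫ D.X) ◁ (Xd ◁ P.T)) ⊗≫
        adj.counit ▷ (D.X ≫ Xd ≫ P.X ≫ D.X) ⊗≫ D.X ◁ adj.counit ▷ D.X ⊗≫ 𝟙 _ := by
      rw [← whisker_exchange]; bicategory
    _ = Xd ◁ Δ[C.X] ▷ P.X ⊗≫
        (Xd ≫ C.X) ◁ (adj.unit ▷ (C.X ≫ P.X) ≫ (P.X ≫ Xd) ◁ P.T) ⊗≫
        Xd ◁ P.T ▷ (Xd ≫ P.X ≫ D.X) ⊗≫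
        adj.counit ▷ (D.X ≫ Xd ≫ P.X ≫ D.X) ⊗≫ D.X ◁ adj.counit ▷ D.X ⊗≫ 𝟙 _ := by
      rw [← whisker_exchange]; bicategory
    _ = Xd ◁ Δ[C.X] ▷ P.X ⊗≫ (Xd ≫ C.X) ◁ P.T ⊗≫
        (Xd ≫ C.X) ◁ adj.unit ▷ (P.X ≫ D.X) ⊗≫ Xd ◁ P.T ▷ (Xd ≫ P.X ≫ D.X) ⊗≫
        (adj.counit ▷ (D.X ≫ (Xd ≫ P.X) ≫ D.X) ≫ 𝟙 b ◁ (D.X ◁ adj.counit ▷ D.X)) ⊗≫ 𝟙 _ := by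
      rw [← whisker_exchange]; bicategory
    _ = Xd ◁ Δ[C.X] ▷ P.X ⊗≫ (Xd ≫ C.X) ◁ P.T ⊗≫
        (Xd ≫ C.X) ◁ adj.unit ▷ (P.X ≫ D.X) ⊗≫
        Xd ◁ (P.T ▷ ((Xd ≫ P.X) ≫ D.X) ≫ (P.X ≫ D.X) ◁ (adj.counit ▷ D.X)) ⊗≫
        adj.counit ▷ (D.X ≫ D.X) ⊗≫ 𝟙 _ := by
      rw [← whisker_exchange]; bicategory
    _ = Xd ◁ Δ[C.X] ▷ P.X ⊗≫ (Xd ≫ C.X) ◁ P.T ⊗≫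
        (Xd ≫ C.X) ◁ leftZigzag adj.unit adj.counit ▷ D.X ⊗≫ Xd ◁ P.T ▷ D.X ⊗≫
        adj.counit ▷ (D.X ≫ D.X) ⊗≫ 𝟙 _ := by
      rw [← whisker_exchange]; bicategory
    _ = Xd ◁ (Δ[C.X] ▷ P.X ≫ (α_ C.X C.X P.X).hom ≫ C.X ◁ P.T ≫ (α_ C.X P.X D.X).inv ≫
        P.T ▷ D.X ≫ (α_ P.X D.X D.X).hom) ⊗≫ adj.counit ▷ (D.X ≫ D.X) ⊗≫ 𝟙 _ := by
      rw [adj.left_triangle]; bicategory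
    _ = Xd ◁ P.T ⊗≫ ((Xd ≫ P.X) ◁ Δ[D.X] ≫ adj.counit ▷ (D.X ≫ D.X)) ⊗≫ 𝟙 _ := by
      rw [← P.pentagon]; bicategory
    _ = _ := by
      rw [whisker_exchange]; bicategory

/-- The morphism of corings `g_T : X_*(C) ⟶ D` attached to a braided bimodule `(X, T)`. -/
def canonicalMap (P : BraidedBimodule C D) {Xd : b ⟶ a} (adj : Bicategory.Adjunction P.X Xd) :
    canonicalCoring C adj ⟶ D where
  hom := canonicalMapHom P adj
  isComonHom_hom :=
    { hom_counit := canonicalMapHom_counit P adj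
      hom_comul := canonicalMapHom_comul P adj }

end Bicat

/-! ### Algebras and bimodules in a closed symmetric monoidal category -/

section Algebras

variable {V : Type u} [Category.{v} V] [MonoidalCategory V]

theorem trivial_actLeft {A : Mon V} (M : Bimod (Mon.trivial V) A) :
    M.actLeft = (MonoidalCategory.leftUnitor M.X).hom := by
  have h := M.one_actLeft
  exact (Category.id_comp _).symm.trans ((congrArg (fun t => t ≫ M.actLeft)
    (MonoidalCategory.id_whiskerRight (MonoidalCategory.tensorUnit V) M.X)).symm.trans h)

theorem unit_one_act (X : V) :
    MonoidalCategory.whiskerRight (𝟙 (MonoidalCategory.tensorUnit V)) X ≫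
      (MonoidalCategory.leftUnitor X).hom = (MonoidalCategory.leftUnitor X).hom := by
  simp

theorem unit_assoc (X : V) :
    MonoidalCategory.whiskerRight
        (MonoidalCategory.leftUnitor (MonoidalCategory.tensorUnit V)).hom X ≫
      (MonoidalCategory.leftUnitor X).hom =
    (MonoidalCategory.associator _ _ X).hom ≫
      MonoidalCategory.whiskerLeft _ (MonoidalCategory.leftUnitor X).hom ≫
        (MonoidalCategory.leftUnitor X).hom := by
  monoidal

theorem unit_middle_assoc {X B : V} (r : MonoidalCategory.tensorObj X B ⟶ X) :
    MonoidalCategory.whiskerRight (MonoidalCategory.leftUnitor X).hom B ≫ r =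
    (MonoidalCategory.associator (MonoidalCategory.tensorUnit V) X B).hom ≫
      MonoidalCategory.whiskerLeft _ r ≫ (MonoidalCategory.leftUnitor X).hom := by
  simp

/-- The right `B`-module underlying an `A`-`B`-bimodule, as a bimodule over the unit algebra and
`B`. -/
def restrictRightObj {A B : Mon V} (X : Bimod A B) : Bimod (Mon.trivial V) B where
  X := X.X
  actLeft := (MonoidalCategory.leftUnitor X.X).hom
  actRight := X.actRight
  one_actLeft := unit_one_act X.X
  left_assoc := unit_assoc X.X
  actRight_one := X.actRight_one
  right_assoc := X.right_assoc
  middle_assoc := unit_middle_assoc X.actRight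

/-- The map of right `B`-modules underlying a map of `A`-`B`-bimodules. -/
def restrictRightMap {A B : Mon V} {X Y : Bimod A B} (f : X ⟶ Y) :
    restrictRightObj X ⟶ restrictRightObj Y where
  hom := f.hom
  left_act_hom := (MonoidalCategory.leftUnitor_naturality f.hom).symm
  right_act_hom := f.right_act_hom

variable (V) in
/-- Algebras (monoids) in `V`, the objects of the bicategory of algebras and bimodules. -/
structure Alg where
  /-- the underlying monoid object -/
  toMon : Mon V

instance preservesColimits_tensorLeft [MonoidalClosed V] (X : V) :
    PreservesColimitsOfSize.{0, 0} (MonoidalCategory.tensorLeft X) :=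
  (ihom.adjunction X).leftAdjoint_preservesColimits

instance preservesColimits_tensorRight [MonoidalClosed V] [SymmetricCategory V] (X : V) :
    PreservesColimitsOfSize.{0, 0} (MonoidalCategory.tensorRight X) :=
  preservesColimits_of_natIso (BraidedCategory.tensorLeftIsoTensorRight X)

variable [SymmetricCategory V] [MonoidalClosed V] [HasCoequalizers V]

/-- The bicategory of algebras and bimodules in `V`: a 1-morphism `A ⟶ B` is an `A`-`B`-bimodule, a
2-morphism is a map of bimodules, and the composite `X ≫ Y` is `X ⊗_B Y`. -/
noncomputable instance : Bicategory (Alg V) where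
  Hom A B := Bimod A.toMon B.toMon
  homCategory A B := (inferInstance : Category (Bimod A.toMon B.toMon))
  id A := Bimod.regular A.toMon
  comp M N := Bimod.tensorBimod M N
  whiskerLeft L _ _ f := Bimod.whiskerLeft L f
  whiskerRight f N := Bimod.whiskerRight f N
  associator := Bimod.associatorBimod
  leftUnitor := Bimod.leftUnitorBimod
  rightUnitor := Bimod.rightUnitorBimod
  whiskerLeft_id _ _ := Bimod.whiskerLeft_id_bimod
  whiskerLeft_comp M _ _ _ f g := Bimod.whiskerLeft_comp_bimod M f g
  id_whiskerLeft := Bimod.id_whiskerLeft_bimod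
  comp_whiskerLeft M N _ _ f := Bimod.comp_whiskerLeft_bimod M N f
  id_whiskerRight _ _ := Bimod.id_whiskerRight_bimod
  comp_whiskerRight f g Q := Bimod.comp_whiskerRight_bimod f g Q
  whiskerRight_id := Bimod.whiskerRight_id_bimod
  whiskerRight_comp := Bimod.whiskerRight_comp_bimod
  whisker_assoc M _ _ f P := Bimod.whisker_assoc_bimod M f P
  whisker_exchange := Bimod.whisker_exchange_bimod
  pentagon := Bimod.pentagon_bimod
  triangle := Bimod.triangle_bimod

variable (V) in
/-- The unit algebra. -/
def unitAlg : Alg V := ⟨Mon.trivial V⟩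

/-- The category `V_A` of right `A`-modules, as bimodules over the unit algebra and `A`: by
`trivial_actLeft` the left action of the unit algebra is no additional data. -/
abbrev RMod (A : Alg V) := unitAlg V ⟶ A

/-- The forgetful functor `V_A ⥤ V`. -/
noncomputable def RMod.forget (A : Alg V) : RMod A ⥤ V where
  obj M := Bimod.X M
  map f := Bimod.Hom.hom f

/-- The functor sending an `A`-`B`-bimodule to its underlying right `B`-module. -/
noncomputable def restrictRight (A B : Alg V) : (A ⟶ B) ⥤ RMod B where
  obj X := restrictRightObj X
  map f := restrictRightMap f

/-- The functor `- ⊗_A X : V_A ⥤ V_B` given by an `A`-`B`-bimodule `X`. -/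
noncomputable def tensorBimodule {A B : Alg V} (X : A ⟶ B) : RMod A ⥤ RMod B :=
  Bicategory.postcomp (unitAlg V) X

/-- An `A`-coring is a comonoid in the monoidal category of `A`-`A`-bimodules. -/
abbrev Coring (A : Alg V) := Comon (A ⟶ A)

/-- The category `V_A^C` of right `(A, C)`-comodules. -/
abbrev Comod {A : Alg V} (C : Coring A) := Comodule (unitAlg V) C

/-- The forgetful functor `V_A^C ⥤ V_A`. -/
noncomputable def Comod.forget {A : Alg V} (C : Coring A) : Comod C ⥤ RMod A :=
  (comoduleComonad (unitAlg V) C).forget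

/-- A left `A`-module `X` (here: the one underlying an `A`-`B`-bimodule) is flat if
`- ⊗_A X : V_A ⥤ V` preserves coreflexive equalizers. -/
def IsFlat {A B : Alg V} (X : A ⟶ B) : Prop :=
  ∀ ⦃M N : RMod A⦄ (f g : M ⟶ N) [IsCoreflexivePair f g],
    PreservesLimit (parallelPair f g) (tensorBimodule X ⋙ RMod.forget B)

end Algebras

/-! ### Model structures -/

section Model

/-- A functor between model categories is left Quillen if it is a left adjoint and preserves
cofibrations and trivial cofibrations. -/
structure IsLeftQuillen {𝒞 : Type*} {𝒟 : Type*} [Category* 𝒞] [Category* 𝒟] [ModelCategory 𝒞]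
    [ModelCategory 𝒟] (F : 𝒞 ⥤ 𝒟) : Prop where
  isLeftAdjoint : F.IsLeftAdjoint
  cofibration {M N : 𝒞} (f : M ⟶ N) (_ : Cofibration f) : Cofibration (F.map f)
  trivialCofibration {M N : 𝒞} (f : M ⟶ N) (_ : Cofibration f) (_ : WeakEquivalence f) :
    Cofibration (F.map f) ∧ WeakEquivalence (F.map f)

/-- An adjunction between model categories is a Quillen equivalence if it is a Quillen adjunction
and, for `M` cofibrant and `N` fibrant, a map `F M ⟶ N` is a weak equivalence if and only if its
adjunct `M ⟶ G N` is. -/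
structure IsQuillenEquivalence {𝒞 : Type*} {𝒟 : Type*} [Category* 𝒞] [Category* 𝒟]
    [ModelCategory 𝒞] [ModelCategory 𝒟] {F : 𝒞 ⥤ 𝒟} {G : 𝒟 ⥤ 𝒞} (adj : F ⊣ G) : Prop where
  isLeftQuillen : IsLeftQuillen F
  weakEquivalence_iff (M : 𝒞) (N : 𝒟) (_ : IsCofibrant M) (_ : IsFibrant N) (f : F.obj M ⟶ N) :
    WeakEquivalence f ↔ WeakEquivalence (adj.homEquiv M N f)

/-- The model structure of `𝒞` is left-induced along `F : 𝒞 ⥤ 𝒟`: a map of `𝒞` is a weak equivalence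
(a cofibration) if and only if its image in `𝒟` is. -/
structure IsLeftInduced {𝒞 : Type*} {𝒟 : Type*} [Category* 𝒞] [Category* 𝒟] [ModelCategory 𝒞]
    [ModelCategory 𝒟] (F : 𝒞 ⥤ 𝒟) : Prop where
  weakEquivalence_iff {M N : 𝒞} (f : M ⟶ N) : WeakEquivalence f ↔ WeakEquivalence (F.map f)
  cofibration_iff {M N : 𝒞} (f : M ⟶ N) : Cofibration f ↔ Cofibration (F.map f)

variable {V : Type u} [Category.{v} V] [MonoidalCategory V]

variable (V) in
/-- The compatibility axiom of a monoidal model category: for cofibrations `i`, `j` and a fibration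
`p`, one of which is a weak equivalence, the pushout-product of `j` and `i` has the left lifting
property with respect to `p`. -/
def PushoutProductAxiom [ModelCategory V] : Prop :=
  ∀ ⦃K L A B X Y : V⦄ (j : K ⟶ L) (i : A ⟶ B) (p : X ⟶ Y),
    Cofibration j → Cofibration i → Fibration p →
    (WeakEquivalence j ∨ WeakEquivalence i ∨ WeakEquivalence p) →
    HasLiftingProperty
      ((MonoidalCategory.Arrow.pushoutProduct.obj (Arrow.mk j)).obj (Arrow.mk i)).hom p

variable [SymmetricCategory V] [MonoidalClosed V] [ModelCategory V]

/-- A left `A`-module `X` (here: the one underlying an `A`-`B`-bimodule) is strongly homotopy flat if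
`- ⊗_A X : V_A ⥤ V` preserves weak equivalences and, up to weak equivalence, finite limits. -/
structure IsStronglyHomotopyFlat {A B : Alg V} [ModelCategory (RMod A)] (X : A ⟶ B) : Prop where
  weakEquivalence ⦃M N : RMod A⦄ (f : M ⟶ N) (_ : WeakEquivalence f) :
    WeakEquivalence ((tensorBimodule X ⋙ RMod.forget B).map f)
  limit_post (J : Type) [SmallCategory J] [FinCategory J] (Φ : J ⥤ RMod A) :
    WeakEquivalence (limit.post Φ (tensorBimodule X ⋙ RMod.forget B))

/-- A bimodule `X` with right dual `Xd` satisfies effective homotopic descent with respect to `C` if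
the canonical adjunction between `C`-comodules and `X_*(C)`-comodules is a Quillen equivalence. -/
def EffectiveHomotopicDescent {A B : Alg V} (C : Coring A) {X : A ⟶ B} {Xd : B ⟶ A}
    (dual : Bicategory.Adjunction X Xd) [ModelCategory (Comod C)]
    [ModelCategory (Comod (canonicalCoring C dual))] : Prop :=
  IsQuillenEquivalence ((universalBraiding C dual).starAdjunction (unitAlg V) dual)

/-- A morphism `f : C ⟶ D` of `A`-corings is a copure weak equivalence if it is a weak equivalence
(of right `A`-modules) and the counit `f_* f^* M ⟶ M` is a weak equivalence for all fibrant right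
`D`-comodules `M`. -/
structure IsCopureWeakEquivalence {A : Alg V} {C D : Coring A} (f : C ⟶ D)
    [ModelCategory (RMod A)] [ModelCategory (Comod C)] [ModelCategory (Comod D)] : Prop where
  weakEquivalence : WeakEquivalence ((restrictRight A A).map f.hom)
  counit (M : Comod D) (_ : IsFibrant M) :
    WeakEquivalence ((changeOfCoringsAdjunction (unitAlg V) f).counit.app M)

end Model

end MoritaTakeuchi

open MoritaTakeuchi

/-!
By the triangle identities, `T^univ` followed by `1 ⊗ g_T` is `T`, so `T_*` is `Can_X` followed by
the change of corings along `g_T`. A change of corings does not alter the underlying modules, hence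
it creates weak equivalences and cofibrations, and it is a Quillen equivalence as soon as its counit
is a weak equivalence at fibrant objects. The first part follows by composing Quillen equivalences.

For the converse, the counit of `T_* ⊣ T^*` at the cofree comodule on a module `Y` is `Y ⊗ g_T`, and
the analogue of `g_T` for `T^univ` is the identity. So the counit of `Can_X ⊣ Prim_X` is invertible
at cofree comodules. Every comodule `N` is a coreflexive equalizer of cofree ones, split on
underlying modules (Beck). `Prim_X`, being a right adjoint, and the forgetful functor, by flatness
of `C`, preserve this equalizer, and strong homotopy flatness says that `- ⊗ X` preserves it up to
weak equivalence. Hence the counit of `Can_X ⊣ Prim_X` is a weak equivalence at `N`. Now `Y = B`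
shows that `g_T` is a weak equivalence, and two-out-of-three applied to the counit of the composite
adjunction shows that it is copure.
-/

namespace MoritaTakeuchi

theorem homEquiv_comp_rightAdjointUniq_hom_app {𝒞 𝒟 : Type*} [Category* 𝒞] [Category* 𝒟]
    {F : 𝒞 ⥤ 𝒟} {G G' : 𝒟 ⥤ 𝒞} (adj : F ⊣ G) (adj' : F ⊣ G') {M : 𝒞} {N : 𝒟}
    (f : F.obj M ⟶ N) :
    adj.homEquiv M N f ≫ (adj.rightAdjointUniq adj').hom.app N = adj'.homEquiv M N f := by
  rw [Adjunction.homEquiv_unit, Adjunction.homEquiv_unit, Category.assoc,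
    NatTrans.naturality, Adjunction.unit_rightAdjointUniq_hom_app_assoc]

section ModelCategories

variable {𝒞 𝒟 ℰ : Type*} [Category* 𝒞] [Category* 𝒟] [Category* ℰ] [ModelCategory 𝒞]
  [ModelCategory 𝒟] [ModelCategory ℰ]

theorem weakEquivalence_map_iff_of_iso {𝒜 : Type*} [Category* 𝒜] {F F' : 𝒜 ⥤ 𝒟} (e : F ≅ F')
    {M N : 𝒜} (f : M ⟶ N) : WeakEquivalence (F.map f) ↔ WeakEquivalence (F'.map f) := by
  simp only [weakEquivalence_iff]
  exact (weakEquivalences 𝒟).arrow_mk_iso_iff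
    (((Functor.mapArrowFunctor _ _).mapIso e).app (Arrow.mk f))

theorem cofibration_map_iff_of_iso {𝒜 : Type*} [Category* 𝒜] {F F' : 𝒜 ⥤ 𝒟} (e : F ≅ F')
    {M N : 𝒜} (f : M ⟶ N) : Cofibration (F.map f) ↔ Cofibration (F'.map f) := by
  simp only [cofibration_iff]
  exact (cofibrations 𝒟).arrow_mk_iso_iff
    (((Functor.mapArrowFunctor _ _).mapIso e).app (Arrow.mk f))

namespace IsLeftQuillen

variable {F : 𝒞 ⥤ 𝒟} {G : 𝒟 ⥤ 𝒞} {F₂ : 𝒟 ⥤ ℰ}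

theorem fibration_map (hF : IsLeftQuillen F) (adj : F ⊣ G) {X Y : 𝒟} (p : X ⟶ Y)
    [Fibration p] : Fibration (G.map p) := by
  rw [fibration_iff, ← trivialCofibrations_rlp]
  intro A B i hi
  obtain ⟨hi, hi'⟩ := (mem_trivialCofibrations_iff i).1 hi
  obtain ⟨hFi, hFi'⟩ := hF.trivialCofibration i hi hi'
  exact (adj.hasLiftingProperty_iff i p).1 inferInstance

theorem isFibrant_obj (hF : IsLeftQuillen F) (adj : F ⊣ G) (X : 𝒟) [IsFibrant X] :
    IsFibrant (G.obj X) :=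
  have : PreservesLimitsOfSize.{0, 0} G := adj.rightAdjoint_preservesLimits
  (isFibrant_iff_of_isTerminal (G.map (terminal.from X))
    (IsTerminal.isTerminalObj G _ terminalIsTerminal)).2 (hF.fibration_map adj _)

theorem isCofibrant_obj (hF : IsLeftQuillen F) (X : 𝒞) [IsCofibrant X] :
    IsCofibrant (F.obj X) :=
  have := hF.isLeftAdjoint
  have : PreservesColimitsOfSize.{0, 0} F :=
    (Adjunction.ofIsLeftAdjoint F).leftAdjoint_preservesColimits
  (isCofibrant_iff_of_isInitial (F.map (initial.to X))
    (IsInitial.isInitialObj F _ initialIsInitial)).2 (hF.cofibration _ inferInstance)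

theorem comp (hF : IsLeftQuillen F) (hF₂ : IsLeftQuillen F₂) : IsLeftQuillen (F ⋙ F₂) where
  isLeftAdjoint :=
    have := hF.isLeftAdjoint
    have := hF₂.isLeftAdjoint
    inferInstance
  cofibration f hf := hF₂.cofibration _ (hF.cofibration f hf)
  trivialCofibration f hf hf' :=
    have ⟨hFf, hFf'⟩ := hF.trivialCofibration f hf hf'
    hF₂.trivialCofibration _ hFf hFf'

theorem of_iso {F' : 𝒞 ⥤ 𝒟} (e : F ≅ F') (hF : IsLeftQuillen F) : IsLeftQuillen F' where
  isLeftAdjoint :=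
    have := hF.isLeftAdjoint
    Functor.isLeftAdjoint_of_iso e
  cofibration f hf := (cofibration_map_iff_of_iso e f).1 (hF.cofibration f hf)
  trivialCofibration f hf hf' :=
    (hF.trivialCofibration f hf hf').imp (cofibration_map_iff_of_iso e f).1
      (weakEquivalence_map_iff_of_iso e f).1

end IsLeftQuillen

namespace IsLeftInduced

variable {F : 𝒞 ⥤ 𝒟} {F₂ : 𝒟 ⥤ ℰ}

theorem of_comp (h₂ : IsLeftInduced F₂) (h : IsLeftInduced (F ⋙ F₂)) : IsLeftInduced F where
  weakEquivalence_iff f := (h.weakEquivalence_iff f).trans (h₂.weakEquivalence_iff _).symm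
  cofibration_iff f := (h.cofibration_iff f).trans (h₂.cofibration_iff _).symm

theorem isLeftQuillen [F.IsLeftAdjoint] (h : IsLeftInduced F) : IsLeftQuillen F where
  isLeftAdjoint := inferInstance
  cofibration f hf := (h.cofibration_iff f).1 hf
  trivialCofibration f hf hf' := ⟨(h.cofibration_iff f).1 hf, (h.weakEquivalence_iff f).1 hf'⟩

theorem isLeftQuillen_of_comp [F.IsLeftAdjoint] (h₂ : IsLeftInduced F₂)
    (h : IsLeftQuillen (F ⋙ F₂)) : IsLeftQuillen F where
  isLeftAdjoint := inferInstance
  cofibration f hf := (h₂.cofibration_iff _).2 (h.cofibration f hf)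
  trivialCofibration f hf hf' :=
    (h.trivialCofibration f hf hf').imp (h₂.cofibration_iff _).2 (h₂.weakEquivalence_iff _).2

end IsLeftInduced

namespace IsQuillenEquivalence

variable {F : 𝒞 ⥤ 𝒟} {G : 𝒟 ⥤ 𝒞} {adj : F ⊣ G} {F₂ : 𝒟 ⥤ ℰ} {G₂ : ℰ ⥤ 𝒟} {adj₂ : F₂ ⊣ G₂}

theorem comp (h : IsQuillenEquivalence adj) (h₂ : IsQuillenEquivalence adj₂) :
    IsQuillenEquivalence (adj.comp adj₂) where
  isLeftQuillen := h.isLeftQuillen.comp h₂.isLeftQuillen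
  weakEquivalence_iff M N hM hN f := by
    rw [Adjunction.comp_homEquiv]
    exact (h₂.weakEquivalence_iff _ N (h.isLeftQuillen.isCofibrant_obj M) hN f).trans
      (h.weakEquivalence_iff M _ hM (h₂.isLeftQuillen.isFibrant_obj adj₂ N) _)

theorem of_iso {F' : 𝒞 ⥤ 𝒟} {G' : 𝒟 ⥤ 𝒞} {adj' : F' ⊣ G'} (e : F ≅ F')
    (h : IsQuillenEquivalence adj) : IsQuillenEquivalence adj' where
  isLeftQuillen := h.isLeftQuillen.of_iso e
  weakEquivalence_iff M N hM hN f := by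
    let i : G ≅ G' := Adjunction.rightAdjointUniq (adj.ofNatIsoLeft e) adj'
    have adjunct_eq : adj'.homEquiv M N f = adj.homEquiv M N (e.hom.app M ≫ f) ≫ i.hom.app N := by
      rw [← Adjunction.homEquiv_ofNatIsoLeft_apply, homEquiv_comp_rightAdjointUniq_hom_app]
    rw [adjunct_eq, weakEquivalence_postcomp_iff, ← h.weakEquivalence_iff M N hM hN,
      weakEquivalence_precomp_iff]

theorem weakEquivalence_counit (h : IsQuillenEquivalence adj)
    (hF : ∀ {M N : 𝒞} (f : M ⟶ N), WeakEquivalence f → WeakEquivalence (F.map f))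
    (N : 𝒟) [IsFibrant N] : WeakEquivalence (adj.counit.app N) := by
  let q := CofibrantObject.HoCat.pResolutionObj (G.obj N)
  have : WeakEquivalence (F.map q) := hF q inferInstance
  have : WeakEquivalence (F.map q ≫ adj.counit.app N) := by
    rw [h.weakEquivalence_iff _ N inferInstance inferInstance,
      ← adj.homEquiv_counit _ _ q, Equiv.apply_symm_apply]
    infer_instance
  exact weakEquivalence_of_precomp (F.map q) _

theorem weakEquivalence_of_map (h : IsQuillenEquivalence adj)
    (hF : ∀ {M N : 𝒞} (f : M ⟶ N), WeakEquivalence f → WeakEquivalence (F.map f))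
    {M N : 𝒞} (f : M ⟶ N) [WeakEquivalence (F.map f)] : WeakEquivalence f := by
  let p (X : 𝒞) := CofibrantObject.HoCat.pResolutionObj X
  let g := CofibrantObject.HoCat.resolutionMap f
  let r := FibrantObject.HoCat.iResolutionObj (F.obj (CofibrantObject.HoCat.resolutionObj N))
  have (X : 𝒞) : WeakEquivalence (F.map (p X)) := hF (p X) inferInstance
  have : WeakEquivalence (F.map g) := by
    have fac : F.map g ≫ F.map (p N) = F.map (p M) ≫ F.map f := by
      rw [← F.map_comp, ← F.map_comp, CofibrantObject.HoCat.resolutionMap_fac]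
    exact weakEquivalence_of_postcomp_of_fac fac
  have adjunct_r : WeakEquivalence (adj.homEquiv _ _ r) :=
    (h.weakEquivalence_iff _ _ inferInstance inferInstance r).1 inferInstance
  have adjunct_comp : WeakEquivalence (g ≫ adj.homEquiv _ _ r) := by
    rw [← Adjunction.homEquiv_naturality_left]
    exact (h.weakEquivalence_iff _ _ inferInstance inferInstance _).1 inferInstance
  rw [← CofibrantObject.HoCat.weakEquivalence_resolutionMap_iff]
  exact weakEquivalence_of_postcomp g (adj.homEquiv _ _ r)

theorem of_weakEquivalence_counit (hF : IsLeftQuillen F)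
    (hw : ∀ {M N : 𝒞} (f : M ⟶ N), WeakEquivalence f ↔ WeakEquivalence (F.map f))
    (hc : ∀ (N : 𝒟) [IsFibrant N], WeakEquivalence (adj.counit.app N)) :
    IsQuillenEquivalence adj where
  isLeftQuillen := hF
  weakEquivalence_iff M N _ _ f := by
    have := hc N
    have counit_fac : F.map (adj.homEquiv M N f) ≫ adj.counit.app N = f :=
      (adj.homEquiv_counit M N _).symm.trans (Equiv.symm_apply_apply _ _)
    rw [hw, ← weakEquivalence_postcomp_iff _ (adj.counit.app N), counit_fac]

theorem of_comp (h : IsQuillenEquivalence (adj.comp adj₂)) (hF₂ : IsLeftInduced F₂)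
    (hF : ∀ {M N : 𝒞} (f : M ⟶ N), WeakEquivalence f → WeakEquivalence (F.map f))
    (hc : ∀ (N : 𝒟) [IsFibrant N], WeakEquivalence (adj.counit.app N)) :
    IsQuillenEquivalence adj := by
  have hcomp {M N : 𝒞} (f : M ⟶ N) :
      WeakEquivalence ((F ⋙ F₂).map f) ↔ WeakEquivalence (F.map f) :=
    (hF₂.weakEquivalence_iff _).symm
  have := adj.isLeftAdjoint
  exact of_weakEquivalence_counit (hF₂.isLeftQuillen_of_comp h.isLeftQuillen)
    (fun f => ⟨hF f, fun hf =>
      have := (hcomp f).2 hf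
      h.weakEquivalence_of_map (fun g hg => (hcomp g).2 (hF g hg)) f⟩) hc

theorem weakEquivalence_counit_of_comp (h : IsQuillenEquivalence (adj.comp adj₂))
    (hF₂ : IsLeftInduced F₂)
    (hF : ∀ {M N : 𝒞} (f : M ⟶ N), WeakEquivalence f → WeakEquivalence (F.map f))
    (hc : ∀ (N : 𝒟) [IsFibrant N], WeakEquivalence (adj.counit.app N)) (N : ℰ) [IsFibrant N] :
    WeakEquivalence (adj₂.counit.app N) := by
  have := adj₂.isLeftAdjoint
  have := hF₂.isLeftQuillen.isFibrant_obj adj₂ N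
  have : WeakEquivalence (F₂.map (adj.counit.app (G₂.obj N))) :=
    (hF₂.weakEquivalence_iff _).1 (hc _)
  have hcomp : WeakEquivalence ((adj.comp adj₂).counit.app N) :=
    h.weakEquivalence_counit (fun f hf => (hF₂.weakEquivalence_iff _).1 (hF f hf)) N
  rw [Adjunction.comp_counit_app] at hcomp
  exact weakEquivalence_of_precomp (F₂.map (adj.counit.app (G₂.obj N))) _

end IsQuillenEquivalence

end ModelCategories

section Limits

variable {J 𝒳 𝒜 𝒟 : Type*} [Category* J] [Category* 𝒳] [Category* 𝒜] [Category* 𝒟]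

theorem app_of_limit_post (W : MorphismProperty 𝒟) [W.RespectsIso] {R : 𝒳 ⥤ 𝒜} {H : 𝒜 ⥤ 𝒟}
    {U : 𝒳 ⥤ 𝒟} (τ : R ⋙ H ⟶ U) {F : J ⥤ 𝒳} [∀ j, IsIso (τ.app (F.obj j))]
    [HasLimit (F ⋙ R)] [HasLimit ((F ⋙ R) ⋙ H)] {c : Cone F} (hR : IsLimit (R.mapCone c))
    (hU : IsLimit (U.mapCone c)) (hH : W (limit.post (F ⋙ R) H)) : W (τ.app c.pt) := by
  let e : (F ⋙ R) ⋙ H ≅ F ⋙ U :=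
    NatIso.ofComponents (fun j => asIso (τ.app (F.obj j))) fun f => τ.naturality (F.map f)
  let i : R.obj c.pt ≅ limit (F ⋙ R) := hR.conePointUniqueUpToIso (limit.isLimit (F ⋙ R))
  let i' : limit ((F ⋙ R) ⋙ H) ≅ U.obj c.pt := (limit.isLimit _).conePointsIsoOfNatIso hU e
  have fac : H.map i.hom ≫ limit.post (F ⋙ R) H ≫ i'.hom = τ.app c.pt := by
    refine hU.hom_ext fun j => ?_
    have hi : i.hom ≫ limit.π (F ⋙ R) j = R.map (c.π.app j) :=
      hR.conePointUniqueUpToIso_hom_comp (limit.isLimit (F ⋙ R)) j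
    have hi' : i'.hom ≫ (U.mapCone c).π.app j = limit.π _ j ≫ e.hom.app j :=
      (limit.isLimit _).conePointsIsoOfNatIso_hom_comp hU e j
    rw [Category.assoc, Category.assoc, hi', limit.post_π_assoc, ← H.map_comp_assoc, hi]
    exact τ.naturality (c.π.app j)
  rw [← fac]
  exact (W.cancel_left_of_respectsIso (H.map i.hom) _).2
    ((W.cancel_right_of_respectsIso _ i'.hom).2 hH)

instance isCoreflexivePair_map (F : 𝒳 ⥤ 𝒟) {X Y : 𝒳} (f g : X ⟶ Y) [IsCoreflexivePair f g] :
    IsCoreflexivePair (F.map f) (F.map g) :=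
  IsCoreflexivePair.mk' (F.map (commonRetraction f g))
    (by rw [← F.map_comp, left_comp_retraction, F.map_id])
    (by rw [← F.map_comp, right_comp_retraction, F.map_id])

end Limits

section Comonads

universe w

variable {𝒳 𝒴 𝒜 𝒟 : Type*} [Category.{w} 𝒳] [Category.{w} 𝒴] [Category.{w} 𝒜] [Category.{w} 𝒟]

theorem preservesLimit_of_isCoreflexivePair (H : 𝒳 ⥤ 𝒟)
    [Comonad.PreservesLimitOfIsCoreflexivePair H] (F : WalkingParallelPair ⥤ 𝒳)
    [IsCoreflexivePair (F.map WalkingParallelPairHom.left) (F.map WalkingParallelPairHom.right)] :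
    PreservesLimit F H :=
  preservesLimit_of_iso_diagram H (diagramIsoParallelPair F).symm

theorem preservesLimitOfIsCoreflexivePair_forget (G : Comonad 𝒴) [HasEqualizers 𝒴]
    [Comonad.PreservesLimitOfIsCoreflexivePair G.toFunctor] :
    Comonad.PreservesLimitOfIsCoreflexivePair G.forget where
  out M N f g _ := by
    let F := parallelPair f g ⋙ G.forget
    have : IsCoreflexivePair (F.map WalkingParallelPairHom.left)
        (F.map WalkingParallelPairHom.right) :=
      isCoreflexivePair_map G.forget f g
    have : IsCoreflexivePair ((F ⋙ G.toFunctor).map WalkingParallelPairHom.left)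
        ((F ⋙ G.toFunctor).map WalkingParallelPairHom.right) :=
      isCoreflexivePair_map G.toFunctor _ _
    have := preservesLimit_of_isCoreflexivePair G.toFunctor F
    have := preservesLimit_of_isCoreflexivePair G.toFunctor (F ⋙ G.toFunctor)
    exact preservesLimit_of_createsLimit_and_hasLimit (parallelPair f g) G.forget

theorem adj_homEquiv_f (G : Comonad 𝒴) (N : G.Coalgebra) (Y : 𝒴)
    (d : G.forget.obj N ⟶ Y) : (G.adj.homEquiv N Y d).f = N.a ≫ G.map d := by
  rw [Adjunction.homEquiv_unit, Comonad.adj_unit]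
  rfl

/-- For `F ⊣ G` and `L ⊣ R`, the counit of the first adjunction on the image of `R` is the adjunct
of the counit of any adjunction `F ⋙ L ⊣ H`. -/
def arrowCounitIso {F : 𝒳 ⥤ 𝒴} {G : 𝒴 ⥤ 𝒳} (adj : F ⊣ G) {L : 𝒴 ⥤ 𝒟} {R : 𝒟 ⥤ 𝒴} (adj₀ : L ⊣ R)
    {H : 𝒟 ⥤ 𝒳} (adj₂ : F ⋙ L ⊣ H) (Y : 𝒟) :
    Arrow.mk (adj.counit.app (R.obj Y)) ≅
      Arrow.mk (adj₀.homEquiv (F.obj (H.obj Y)) Y (adj₂.counit.app Y)) :=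
  Arrow.isoMk (F.mapIso (((adj.comp adj₀).rightAdjointUniq adj₂).app Y)) (Iso.refl _) (by
    have h := Adjunction.rightAdjointUniq_hom_app_counit (adj.comp adj₀) adj₂ Y
    rw [Adjunction.comp_counit_app, ← adj₀.homEquiv_counit (F.obj (G.obj (R.obj Y)))] at h
    have h' := (adj₀.homEquiv _ _).symm_apply_eq.1 h.symm
    refine Eq.trans ?_ (h'.symm.trans (Category.comp_id _).symm)
    exact (adj₀.homEquiv_naturality_left _ _).symm)

theorem map_counit_of_isIso_counit_cofree {G : Comonad 𝒴} (W : MorphismProperty 𝒟)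
    [W.RespectsIso] {S : 𝒳 ⥤ G.Coalgebra} {Q : G.Coalgebra ⥤ 𝒳} (adj : S ⊣ Q)
    (hcofree : ∀ Y, IsIso (adj.counit.app (G.cofree.obj Y)))
    {A : 𝒳 ⥤ 𝒜} [Comonad.PreservesLimitOfIsCoreflexivePair A] [HasEqualizers 𝒜] [HasEqualizers 𝒟]
    {H : 𝒜 ⥤ 𝒟} {U : 𝒴 ⥤ 𝒟} (e : A ⋙ H ≅ S ⋙ G.forget ⋙ U)
    (hH : ∀ Φ : WalkingParallelPair ⥤ 𝒜, W (limit.post Φ H)) (N : G.Coalgebra) :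
    W (U.map (adj.counit.app N).f) := by
  let Φ := parallelPair (Comonad.CofreeEqualizer.topMap N) (Comonad.CofreeEqualizer.bottomMap N)
  let τ : (Q ⋙ A) ⋙ H ⟶ G.forget ⋙ U :=
    Functor.whiskerLeft Q e.hom ≫ Functor.whiskerRight adj.counit (G.forget ⋙ U)
  have (j : WalkingParallelPair) : IsIso (adj.counit.app (Φ.obj j)) := by
    cases j <;> exact hcofree _
  have (j : WalkingParallelPair) : IsIso (τ.app (Φ.obj j)) := by
    dsimp only [τ, NatTrans.comp_app, Functor.whiskerRight_app, Functor.whiskerLeft_app]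
    infer_instance
  have := adj.rightAdjoint_preservesLimits
  have : IsCoreflexivePair ((Φ ⋙ Q).map WalkingParallelPairHom.left)
      ((Φ ⋙ Q).map WalkingParallelPairHom.right) :=
    isCoreflexivePair_map Q (Comonad.CofreeEqualizer.topMap N) (Comonad.CofreeEqualizer.bottomMap N)
  have := preservesLimit_of_isCoreflexivePair A (Φ ⋙ Q)
  have hA : IsLimit ((Q ⋙ A).mapCone (Comonad.beckCoalgebraFork N)) :=
    isLimitOfPreserves A (isLimitOfPreserves Q (Comonad.beckCoalgebraEqualizer N))
  have hU : IsLimit ((G.forget ⋙ U).mapCone (Comonad.beckCoalgebraFork N)) :=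
    (isLimitMapConeForkEquiv (G.forget ⋙ U) (Comonad.CofreeEqualizer.condition N)).symm
      ((Comonad.beckSplitEqualizer N).map U).isEqualizer
  have hτ := app_of_limit_post W τ hA hU (hH _)
  exact (W.cancel_left_of_respectsIso (e.hom.app (Q.obj N)) _).1 hτ

end Comonads

section BraidedBimodules

open Bicategory

universe w v₁ u₁

variable {𝓑 : Type u₁} [Bicategory.{w, v₁} 𝓑] {a b : 𝓑} {C : Comon (a ⟶ a)} {D : Comon (b ⟶ b)}

theorem universalBraiding_comp_canonicalMapHom (P : BraidedBimodule C D) {Xd : b ⟶ a}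
    (adj : Bicategory.Adjunction P.X Xd) :
    (universalBraiding C adj).T ≫ P.X ◁ canonicalMapHom P adj = P.T := by
  dsimp only [universalBraiding, canonicalCoring, canonicalMapHom]
  calc
    _ = 𝟙 _ ⊗≫ (adj.unit ▷ (C.X ≫ P.X) ≫ (P.X ≫ Xd) ◁ P.T) ⊗≫ P.X ◁ adj.counit ▷ D.X ⊗≫ 𝟙 _ := by
      bicategory
    _ = P.T ⊗≫ leftZigzag adj.unit adj.counit ▷ D.X ⊗≫ 𝟙 _ := by
      rw [← whisker_exchange]; bicategory
    _ = _ := by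
      rw [adj.left_triangle]; bicategory

theorem canonicalMapHom_universalBraiding (C : Comon (a ⟶ a)) {X : a ⟶ b} {Xd : b ⟶ a}
    (adj : Bicategory.Adjunction X Xd) :
    canonicalMapHom (universalBraiding C adj) adj = 𝟙 (Xd ≫ C.X ≫ X) := by
  dsimp only [universalBraiding, canonicalCoring, canonicalMapHom]
  calc
    _ = 𝟙 _ ⊗≫ rightZigzag adj.unit adj.counit ▷ (C.X ≫ X) ⊗≫ 𝟙 _ := by bicategory
    _ = _ := by
      rw [adj.right_triangle]; bicategory

/-- The factorization of `T_*` as `Can_X` followed by the change of corings along `g_T`. -/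
def lowerStarIso (k : 𝓑) (P : BraidedBimodule C D) {Xd : b ⟶ a}
    (adj : Bicategory.Adjunction P.X Xd) :
    (universalBraiding C adj).lowerStar k ⋙ changeOfCorings k (canonicalMap P adj) ≅
      P.lowerStar k :=
  NatIso.ofComponents (fun M => Comonad.Coalgebra.isoMk (Iso.refl (M.A ≫ P.X)) (by
      have fac : ((λ_ (C.X ≫ P.X)).inv ≫ adj.unit ▷ (C.X ≫ P.X) ≫ (α_ P.X Xd (C.X ≫ P.X)).hom) ≫
          P.X ◁ canonicalMapHom P adj = P.T :=
        universalBraiding_comp_canonicalMapHom P adj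
      change ((M.coact ▷ P.X ≫ (α_ M.A C.X P.X).hom ≫
        M.A ◁ ((λ_ (C.X ≫ P.X)).inv ≫ adj.unit ▷ (C.X ≫ P.X) ≫ (α_ P.X Xd (C.X ≫ P.X)).hom) ≫
        (α_ M.A P.X (Xd ≫ C.X ≫ P.X)).inv) ≫ (M.A ≫ P.X) ◁ canonicalMapHom P adj) ≫
        𝟙 (M.A ≫ P.X) ▷ D.X = 𝟙 (M.A ≫ P.X) ≫ M.coact ▷ P.X ≫ (α_ M.A C.X P.X).hom ≫ M.A ◁ P.T ≫
          (α_ M.A P.X D.X).inv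
      rw [← fac]
      bicategory))
    fun f => Comonad.Coalgebra.Hom.ext ((Category.comp_id _).trans (Category.id_comp _).symm)

theorem homEquiv_counit_cofree_f (k : 𝓑) (P : BraidedBimodule C D) {Xd : b ⟶ a}
    (adj : Bicategory.Adjunction P.X Xd) (Y : k ⟶ b) :
    ((comoduleComonad k D).adj.homEquiv
      ((P.lowerStar k).obj ((comoduleComonad k C).cofree.obj (Y ≫ Xd))) Y
      (((comoduleComonad k C).adj.comp (postcompAdjunction k adj)).counit.app Y)).f =
      (α_ (Y ≫ Xd) C.X P.X).hom ≫ (α_ Y Xd (C.X ≫ P.X)).hom ≫ Y ◁ canonicalMapHom P adj := by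
  refine (adj_homEquiv_f _ _ _ _).trans ?_
  have counit_eq : ((comoduleComonad k C).adj.comp (postcompAdjunction k adj)).counit.app Y =
      ((Y ≫ Xd) ◁ ε[C.X] ≫ (ρ_ (Y ≫ Xd)).hom) ▷ P.X ≫ (α_ Y Xd P.X).hom ≫ Y ◁ adj.counit ≫
        (ρ_ Y).hom := by
    rw [Adjunction.comp_counit_app, Comonad.adj_counit]
    rfl
  refine (congrArg (fun d => _ ≫ d ▷ D.X) counit_eq).trans ?_
  change (((Y ≫ Xd) ◁ Δ[C.X] ≫ (α_ (Y ≫ Xd) C.X C.X).inv) ▷ P.X ≫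
      (α_ ((Y ≫ Xd) ≫ C.X) C.X P.X).hom ≫ ((Y ≫ Xd) ≫ C.X) ◁ P.T ≫
        (α_ ((Y ≫ Xd) ≫ C.X) P.X D.X).inv) ≫
      (((Y ≫ Xd) ◁ ε[C.X] ≫ (ρ_ (Y ≫ Xd)).hom) ▷ P.X ≫ (α_ Y Xd P.X).hom ≫ Y ◁ adj.counit ≫
        (ρ_ Y).hom) ▷ D.X = _
  dsimp only [canonicalMapHom]
  calc
    _ = 𝟙 _ ⊗≫ (Y ≫ Xd) ◁ Δ[C.X] ▷ P.X ⊗≫ (Y ≫ Xd) ◁ (C.X ◁ P.T ≫ ε[C.X] ▷ (P.X ≫ D.X)) ⊗≫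
        Y ◁ adj.counit ▷ D.X ⊗≫ 𝟙 (Y ≫ D.X) := by bicategory
    _ = 𝟙 _ ⊗≫ (Y ≫ Xd) ◁ (Δ[C.X] ≫ ε[C.X] ▷ C.X) ▷ P.X ⊗≫ (Y ≫ Xd) ◁ P.T ⊗≫
        Y ◁ adj.counit ▷ D.X ⊗≫ 𝟙 (Y ≫ D.X) := by
      rw [whisker_exchange]; bicategory
    _ = _ := by
      rw [Comonad.counit_comul]; bicategory

/-- The counit of `T_* ⊣ T^*` at the cofree comodule on `Y` is `Y ◁ g_T`, up to isomorphism. -/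
def arrowCounitCofreeIso (k : 𝓑) (P : BraidedBimodule C D) {Xd : b ⟶ a}
    (adj : Bicategory.Adjunction P.X Xd) {Q : Comodule k D ⥤ Comodule k C}
    (adj' : CategoryTheory.Adjunction (P.lowerStar k) Q) (Y : k ⟶ b) :
    Arrow.mk (adj'.counit.app ((comoduleComonad k D).cofree.obj Y)).f ≅
      Arrow.mk (Y ◁ canonicalMapHom P adj) :=
  (comoduleComonad k D).forget.mapArrow.mapIso (arrowCounitIso adj' (comoduleComonad k D).adj
    ((comoduleComonad k C).adj.comp (postcompAdjunction k adj)) Y) ≪≫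
    Arrow.isoMk (α_ (Y ≫ Xd) C.X P.X ≪≫ α_ Y Xd (C.X ≫ P.X)) (Iso.refl _)
      ((Category.assoc _ _ _).trans ((homEquiv_counit_cofree_f k P adj Y).symm.trans
        (Category.comp_id _).symm))

theorem isIso_counit_cofree_universalBraiding (k : 𝓑) (C : Comon (a ⟶ a)) {X : a ⟶ b}
    {Xd : b ⟶ a} (adj : Bicategory.Adjunction X Xd)
    {Q : Comodule k (canonicalCoring C adj) ⥤ Comodule k C}
    (adj' : CategoryTheory.Adjunction ((universalBraiding C adj).lowerStar k) Q) (Y : k ⟶ b) :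
    IsIso (adj'.counit.app ((comoduleComonad k (canonicalCoring C adj)).cofree.obj Y)) := by
  have hmap : Y ◁ canonicalMapHom (universalBraiding C adj) adj = 𝟙 (Y ≫ Xd ≫ C.X ≫ X) :=
    (congrArg (Y ◁ ·) (canonicalMapHom_universalBraiding C adj)).trans
      (Bicategory.whiskerLeft_id Y _)
  have : IsIso (Y ◁ canonicalMapHom (universalBraiding C adj) adj) := by
    rw [hmap]
    exact IsIso.id _
  have : IsIso (adj'.counit.app ((comoduleComonad k (canonicalCoring C adj)).cofree.obj Y)).f :=
    (MorphismProperty.isomorphisms (k ⟶ b)).arrow_mk_iso_iff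
      (arrowCounitCofreeIso k (universalBraiding C adj) adj adj' Y) |>.2 ‹_›
  exact Comonad.coalgebra_iso_of_iso _ _

theorem map_counit_universalBraiding {𝒟 : Type*} [Category.{w} 𝒟] (W : MorphismProperty 𝒟)
    [W.RespectsIso] [HasEqualizers 𝒟] (k : 𝓑) [HasEqualizers (k ⟶ a)]
    [Comonad.PreservesLimitOfIsCoreflexivePair (postcomp k C.X)] {X : a ⟶ b} {Xd : b ⟶ a}
    (adj : Bicategory.Adjunction X Xd) {Q : Comodule k (canonicalCoring C adj) ⥤ Comodule k C}
    (adj' : CategoryTheory.Adjunction ((universalBraiding C adj).lowerStar k) Q)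
    (U : (k ⟶ b) ⥤ 𝒟)
    (hU : ∀ Φ : WalkingParallelPair ⥤ (k ⟶ a), W (limit.post Φ (postcomp k X ⋙ U)))
    (N : Comodule k (canonicalCoring C adj)) : W (U.map (adj'.counit.app N).f) := by
  have : Comonad.PreservesLimitOfIsCoreflexivePair (comoduleComonad k C).toFunctor :=
    inferInstanceAs (Comonad.PreservesLimitOfIsCoreflexivePair (postcomp k C.X))
  have := preservesLimitOfIsCoreflexivePair_forget (comoduleComonad k C)
  exact map_counit_of_isIso_counit_cofree W adj'
    (isIso_counit_cofree_universalBraiding k C adj adj')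
    (Iso.refl ((comoduleComonad k C).forget ⋙ postcomp k X ⋙ U)) hU N

end BraidedBimodules

section Modules

variable {V : Type u} [Category.{v} V] [MonoidalCategory V] [SymmetricCategory V]
  [MonoidalClosed V] [HasCoequalizers V]

theorem RMod.actLeft_comp {A : Alg V} (M N : RMod A) (f : Bimod.X M ⟶ Bimod.X N) :
    Bimod.actLeft M ≫ f =
      MonoidalCategory.whiskerLeft (MonoidalCategory.tensorUnit V) f ≫ Bimod.actLeft N := by
  have hM : Bimod.actLeft M = _ := trivial_actLeft (A := A.toMon) M
  have hN : Bimod.actLeft N = _ := trivial_actLeft (A := A.toMon) N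
  rw [hM, hN]
  exact (MonoidalCategory.leftUnitor_naturality f).symm

/-- A cone of right modules whose image in `V` is a limit cone is a limit cone. -/
noncomputable def RMod.isLimitOfForget {J : Type*} [Category* J] {A : Alg V} {F : J ⥤ RMod A}
    (c : Cone F) (h : IsLimit ((RMod.forget A).mapCone c)) : IsLimit c where
  lift s :=
    { hom := h.lift ((RMod.forget A).mapCone s)
      left_act_hom := RMod.actLeft_comp s.pt c.pt (h.lift ((RMod.forget A).mapCone s))
      right_act_hom := by
        refine h.hom_ext fun j => ?_
        let l : Bimod.X s.pt ⟶ Bimod.X c.pt := h.lift ((RMod.forget A).mapCone s)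
        let p : Bimod.X c.pt ⟶ Bimod.X (F.obj j) := Bimod.Hom.hom (c.π.app j)
        let q : Bimod.X s.pt ⟶ Bimod.X (F.obj j) := Bimod.Hom.hom (s.π.app j)
        have hl : l ≫ p = q := h.fac ((RMod.forget A).mapCone s) j
        have hp : Bimod.actRight c.pt ≫ p = _ ≫ _ := Bimod.Hom.right_act_hom (c.π.app j)
        have hq : Bimod.actRight s.pt ≫ q = _ ≫ _ := Bimod.Hom.right_act_hom (s.π.app j)
        change (Bimod.actRight s.pt ≫ l) ≫ p =
          (MonoidalCategory.whiskerRight l A.toMon.X ≫ Bimod.actRight c.pt) ≫ p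
        rw [Category.assoc, Category.assoc, hl, hp, hq, ← MonoidalCategory.comp_whiskerRight_assoc]
        exact congrArg (fun t => MonoidalCategory.whiskerRight t A.toMon.X ≫
          Bimod.actRight (F.obj j)) hl.symm }
  fac s j := Bimod.hom_ext _ _ (h.fac ((RMod.forget A).mapCone s) j)
  uniq s m hm := Bimod.hom_ext _ _ (h.uniq ((RMod.forget A).mapCone s) m.hom
    fun j => congrArg Bimod.Hom.hom (hm j))

instance {J : Type*} [Category* J] (A : Alg V) : ReflectsLimitsOfShape J (RMod.forget A) where
  reflectsLimit := ⟨fun h => ⟨RMod.isLimitOfForget _ h⟩⟩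

theorem IsFlat.preservesLimitOfIsCoreflexivePair {A B : Alg V} {X : A ⟶ B} (hX : IsFlat X) :
    Comonad.PreservesLimitOfIsCoreflexivePair (Bicategory.postcomp (unitAlg V) X) where
  out _ _ f g _ :=
    have : PreservesLimit (parallelPair f g)
      (Bicategory.postcomp (unitAlg V) X ⋙ RMod.forget B) := hX f g
    preservesLimit_of_reflects_of_preserves (Bicategory.postcomp (unitAlg V) X) (RMod.forget B)

/-- Restriction along the unit commutes with tensoring on the right. -/
noncomputable def restrictRightTensorIso {A B E : Alg V} (X : A ⟶ B) (Y : B ⟶ E) :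
    (restrictRight A E).obj (X ≫ Y) ≅ (restrictRight A B).obj X ≫ Y :=
  Bimod.isoOfIso (P := restrictRightObj (Bimod.tensorBimod X Y))
    (Q := Bimod.tensorBimod (restrictRightObj X) Y) (Iso.refl (Bimod.TensorBimod.X X Y))
    (RMod.actLeft_comp ((restrictRight A E).obj (X ≫ Y)) ((restrictRight A B).obj X ≫ Y) (𝟙 _))
    (by
      change Bimod.TensorBimod.actRight X Y ≫ 𝟙 (Bimod.TensorBimod.X X Y) =
        MonoidalCategory.whiskerRight (𝟙 (Bimod.TensorBimod.X X Y)) E.toMon.X ≫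
          Bimod.TensorBimod.actRight X Y
      rw [MonoidalCategory.id_whiskerRight, Category.comp_id, Category.id_comp])

open Bicategory

theorem restrictRightTensorIso_naturality {A B E : Alg V} (X : A ⟶ B) {Y Z : B ⟶ E} (f : Y ⟶ Z) :
    (restrictRight A E).map (X ◁ f) ≫ (restrictRightTensorIso X Z).hom =
      (restrictRightTensorIso X Y).hom ≫ (restrictRight A B).obj X ◁ f := by
  apply Bimod.hom_ext
  exact (Category.comp_id _).trans (Category.id_comp _).symm

/-- The right module underlying a bimodule `Y` is the regular right module tensored with `Y`. -/
noncomputable def restrictRightIso (A B : Alg V) :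
    restrictRight A B ≅ precomp B ((restrictRight A A).obj (𝟙 A)) :=
  NatIso.ofComponents
    (fun Y => (restrictRight A B).mapIso (λ_ Y).symm ≪≫ restrictRightTensorIso (𝟙 A) Y) (by
      intro Y Z f
      have unitor_naturality : f ≫ (λ_ Z).inv = (λ_ Y).inv ≫ 𝟙 A ◁ f := by
        rw [id_whiskerLeft, Iso.inv_hom_id_assoc]
      change (restrictRight A B).map f ≫ (restrictRight A B).map (λ_ Z).inv ≫
        (restrictRightTensorIso (𝟙 A) Z).hom = ((restrictRight A B).map (λ_ Y).inv ≫
        (restrictRightTensorIso (𝟙 A) Y).hom) ≫ (restrictRight A A).obj (𝟙 A) ◁ f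
      rw [Category.assoc, ← restrictRightTensorIso_naturality, ← Functor.map_comp_assoc,
        ← Functor.map_comp_assoc, unitor_naturality])

end Modules

section ModelComodules

open Bicategory

variable {V : Type u} [Category.{v} V] [MonoidalCategory V] [SymmetricCategory V]
  [MonoidalClosed V] [ModelCategory V] {A B : Alg V} {C : Coring A} {D : Coring B}

theorem isLeftInduced_changeOfCorings {C D : Coring A} [ModelCategory (RMod A)]
    [ModelCategory (Comod C)] [ModelCategory (Comod D)] (hC : IsLeftInduced (Comod.forget C))
    (hD : IsLeftInduced (Comod.forget D)) (g : C ⟶ D) :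
    IsLeftInduced (changeOfCorings (unitAlg V) g) :=
  hD.of_comp hC

theorem isQuillenEquivalence_changeOfCorings {C D : Coring A} [ModelCategory (RMod A)]
    [ModelCategory (Comod C)] [ModelCategory (Comod D)] (hC : IsLeftInduced (Comod.forget C))
    (hD : IsLeftInduced (Comod.forget D)) {g : C ⟶ D} (hg : IsCopureWeakEquivalence g) :
    IsQuillenEquivalence (changeOfCoringsAdjunction (unitAlg V) g) :=
  have := isLeftAdjoint_changeOfCorings (unitAlg V) g
  have hInd := isLeftInduced_changeOfCorings hC hD g
  .of_weakEquivalence_counit hInd.isLeftQuillen hInd.weakEquivalence_iff hg.counit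

theorem weakEquivalence_lowerStar_map [ModelCategory (RMod A)] [ModelCategory (RMod B)]
    [ModelCategory (Comod C)] [ModelCategory (Comod D)] (hC : IsLeftInduced (Comod.forget C))
    (hD : IsLeftInduced (Comod.forget D)) (P : BraidedBimodule C D)
    (hP : ∀ {M N : RMod A} (f : M ⟶ N), WeakEquivalence f →
      WeakEquivalence ((tensorBimodule P.X).map f))
    {M N : Comod C} (f : M ⟶ N) (hf : WeakEquivalence f) :
    WeakEquivalence ((P.lowerStar (unitAlg V)).map f) :=
  (hD.weakEquivalence_iff _).2 (hP f.f ((hC.weakEquivalence_iff f).1 hf))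

theorem weakEquivalence_restrictRight_canonicalMap [ModelCategory (RMod B)]
    [ModelCategory (Comod D)] (hD : IsLeftInduced (Comod.forget D)) (P : BraidedBimodule C D)
    {Xd : B ⟶ A} (dual : Bicategory.Adjunction P.X Xd) {Q : Comod D ⥤ Comod C}
    (adj : CategoryTheory.Adjunction (P.lowerStar (unitAlg V)) Q)
    (hB : IsFibrant ((restrictRight B B).obj (𝟙 B)))
    (hc : ∀ (N : Comod D) [IsFibrant N], WeakEquivalence (adj.counit.app N)) :
    WeakEquivalence ((restrictRight B B).map (canonicalMap P dual).hom) := by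
  let G := comoduleComonad (unitAlg V) D
  let Y : RMod B := (restrictRight B B).obj (𝟙 B)
  have : (Comod.forget D).IsLeftAdjoint := inferInstanceAs G.forget.IsLeftAdjoint
  have : IsFibrant (G.cofree.obj Y) := hD.isLeftQuillen.isFibrant_obj G.adj Y
  have counit_cofree : WeakEquivalence (adj.counit.app (G.cofree.obj Y)).f :=
    (hD.weakEquivalence_iff _).1 (hc _)
  rw [weakEquivalence_map_iff_of_iso (restrictRightIso B B)]
  rw [weakEquivalence_iff] at counit_cofree ⊢
  exact ((weakEquivalences (RMod B)).arrow_mk_iso_iff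
    (arrowCounitCofreeIso (unitAlg V) P dual adj Y)).1 counit_cofree

theorem weakEquivalence_counit_universalBraiding [ModelCategory (RMod A)] {X : A ⟶ B}
    {Xd : B ⟶ A} (dual : Bicategory.Adjunction X Xd) (hC : IsFlat C.X)
    (hX : IsStronglyHomotopyFlat X) {Q : Comod (canonicalCoring C dual) ⥤ Comod C}
    (adj : CategoryTheory.Adjunction ((universalBraiding C dual).lowerStar (unitAlg V)) Q)
    (N : Comod (canonicalCoring C dual)) :
    WeakEquivalence ((RMod.forget B).map (adj.counit.app N).f) := by
  have := hC.preservesLimitOfIsCoreflexivePair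
  rw [weakEquivalence_iff]
  exact map_counit_universalBraiding (weakEquivalences V) (unitAlg V) dual adj (RMod.forget B)
    (fun Φ => (weakEquivalence_iff _).1 (hX.limit_post WalkingParallelPair Φ)) N

end ModelComodules

end MoritaTakeuchi

open Bicategory in
theorem mainTheorem1_general {V : Type u} [Category.{v} V] [MonoidalCategory V]
    [SymmetricCategory V] [MonoidalClosed V] [ModelCategory V] {A B : Alg V} {C : Coring A}
    {D : Coring B} [ModelCategory (RMod A)] [ModelCategory (RMod B)] [ModelCategory (Comod C)]
    [ModelCategory (Comod D)] (P : BraidedBimodule C D) {Xd : B ⟶ A}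
    (dual : Bicategory.Adjunction P.X Xd) [ModelCategory (Comod (canonicalCoring C dual))]
    (hC : IsLeftInduced (Comod.forget C)) (hD : IsLeftInduced (Comod.forget D))
    (hK : IsLeftInduced (Comod.forget (canonicalCoring C dual))) :
    (EffectiveHomotopicDescent C dual ∧ IsCopureWeakEquivalence (canonicalMap P dual) →
      IsQuillenEquivalence (P.starAdjunction (unitAlg V) dual)) ∧
    ((∀ {M N : RMod B} (f : M ⟶ N), WeakEquivalence ((RMod.forget B).map f) → WeakEquivalence f) →
      IsFibrant ((restrictRight B B).obj (𝟙 B)) →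
      IsFlat C.X →
      IsStronglyHomotopyFlat P.X →
      IsQuillenEquivalence (P.starAdjunction (unitAlg V) dual) →
      EffectiveHomotopicDescent C dual ∧ IsCopureWeakEquivalence (canonicalMap P dual)) := by
  let can := (universalBraiding C dual).starAdjunction (unitAlg V) dual
  let changeG := changeOfCoringsAdjunction (unitAlg V) (canonicalMap P dual)
  refine ⟨fun ⟨hdescent, hcopure⟩ => ?_, fun hreflect hB hflat hX hT => ?_⟩
  · exact (hdescent.comp (isQuillenEquivalence_changeOfCorings hK hD hcopure)).of_iso
      (lowerStarIso _ P dual)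
  have tensor_map {M N : RMod A} (f : M ⟶ N) (hf : WeakEquivalence f) :
      WeakEquivalence ((tensorBimodule P.X).map f) := hreflect _ (hX.weakEquivalence f hf)
  have can_map {M N : Comod C} (f : M ⟶ N) (hf : WeakEquivalence f) :=
    weakEquivalence_lowerStar_map hC hK (universalBraiding C dual) tensor_map f hf
  have star_map {M N : Comod C} (f : M ⟶ N) (hf : WeakEquivalence f) :=
    weakEquivalence_lowerStar_map hC hD P tensor_map f hf
  have can_counit (N : Comod (canonicalCoring C dual)) : WeakEquivalence (can.counit.app N) :=
    (hK.weakEquivalence_iff _).2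
      (hreflect _ (weakEquivalence_counit_universalBraiding dual hflat hX can N))
  have hcomp : IsQuillenEquivalence (can.comp changeG) := hT.of_iso (lowerStarIso _ P dual).symm
  have hg := isLeftInduced_changeOfCorings hK hD (canonicalMap P dual)
  refine ⟨hcomp.of_comp hg can_map fun N _ => can_counit N, ?_, fun N _ => ?_⟩
  · exact weakEquivalence_restrictRight_canonicalMap hD P dual _ hB fun N _ =>
      hT.weakEquivalence_counit star_map N
  · exact hcomp.weakEquivalence_counit_of_comp hg can_map (fun N _ => can_counit N) N

theorem mainTheorem1 {V : Type u} [Category.{v} V] [MonoidalCategory V] [SymmetricCategory V]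
    [MonoidalClosed V] [ModelCategory V] (hV : PushoutProductAxiom V)
    [∀ A : Alg V, ModelCategory (RMod A)]
    [∀ (A : Alg V) (C : Coring A), ModelCategory (Comod C)]
    (hind : ∀ (A : Alg V) (C : Coring A), IsLeftInduced (Comod.forget C))
    {A B : Alg V} {C : Coring A} {D : Coring B} (P : BraidedBimodule C D)
    {Xd : B ⟶ A} (dual : Bicategory.Adjunction P.X Xd)
    (hX : IsLeftQuillen (tensorBimodule P.X)) :
    (EffectiveHomotopicDescent C dual ∧ IsCopureWeakEquivalence (canonicalMap P dual) →
      IsQuillenEquivalence (P.starAdjunction (unitAlg V) dual)) ∧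
    ((∀ {M N : RMod B} (f : M ⟶ N), WeakEquivalence ((RMod.forget B).map f) → WeakEquivalence f) →
      IsFibrant ((restrictRight B B).obj (𝟙 B)) →
      IsFlat C.X →
      IsStronglyHomotopyFlat P.X →
      IsQuillenEquivalence (P.starAdjunction (unitAlg V) dual) →
      EffectiveHomotopicDescent C dual ∧ IsCopureWeakEquivalence (canonicalMap P dual)) :=
  mainTheorem1_general P dual (hind A C) (hind B D) (hind B _)
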